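/- **Definitions.** For a cardinal $\theta$, $H_\theta$ is the collection of sets whose transitive closure has size less than $\theta$, and $\mathcal P_\mu(X)=\{y\subseteq X:|y|<\mu\}$. A set $\mathcal S\subseteq \mathcal P_\mu(X)$ is stationary if for every $F:\mathcal P_\omega(X)\to\mathcal P_\mu(X)$ there is $A\in\mathcal S$ with $F(a)\subseteq A$ for every finite $a\subseteq A$. A powerful model is a transitive set or class $\mathcal H$ such that $(\mathcal H,\in)$ satisfies $\mathrm{ZFC}$ without the power set axiom and $x\in\mathcal H$ whenever $x\subseteq y\in\mathcal H$. For a set $M$, $\kappa_M$ denotes the least ordinal $\alpha\in M$ with $\alpha\not\subseteq M$, if there is one. For a regular cardinal $\delta$, a set $M$ is a $\delta$-guessing elementary submodel if $M\prec\mathcal H$ for some powerful model $\mathcal H$, $\kappa_M$ is defined, $\delta\in M$, $\delta\le\kappa_M$, and the following holds: whenever $x$ is a set such that $x\subseteq y$ for some $y\in M$ and such that $x\cap a\in M$ for every $a\in M$ with $|a|^M<\delta$, there is $x^*\in M$ with $x^*\cap M=x\cap M$. For regular uncountable cardinals $\delta\le\kappa$, a set $M$ of cardinality $\kappa^+$ is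 strongly $\delta$-guessing if $M=\bigcup_{\xi<\kappa^+}M_\xi$ for some sequence $\langle M_\xi:\xi<\kappa^+\rangle$ of $\delta$-guessing elementary submodels of cardinality $\kappa$ such that $M_\xi\in M_\eta$ for $\xi<\eta<\kappa^+$, and $M_\xi=\bigcup_{\eta<\xi}M_\eta$ for every $\xi<\kappa^+$ of cofinality $\kappa$. The principle $\mathrm{GMP}^+(\kappa^{++},\delta)$ states that for every sufficiently large regular cardinal $\theta$, the set of all strongly $\delta$-guessing $M\in\mathcal P_{\kappa^{++}}(H_\theta)$ with $M\prec H_\theta$ is stationary in $\mathcal P_{\kappa^{++}}(H_\theta)$. Let $\lambda$ be a regular cardinal. For a sequence $\bar a=\langle a_\xi:\xi<\lambda\rangle$ of bounded subsets of $\lambda$, let $B(\bar a)$ be the set of all $\delta<\lambda$ for which there is a cofinal subset $c\subseteq\delta$ of order type less than $\delta$ such that for every $\gamma<\delta$ there is $\eta<\delta$ with $c\cap\gamma=a_\eta$. Let $\mathrm{NS}_\lambda$ be the nonstationary ideal on $\lambda$, and let $I[\lambda]$ be the (possibly improper) ideal of subsets of $\lambda$ generated by $\mathrm{NS}_\lambda$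 and all the sets $B(\bar a)$. For an ideal $I$ on $\lambda$ and $S\subseteq\lambda$, put $I\restriction S=\{A\in I:A\subseteq S\}$. For a regular cardinal $\kappa$, let $S^{\kappa^+}_\kappa=\{\delta<\kappa^+:\operatorname{cof}(\delta)=\kappa\}$, and let $\mathrm{MP}(\kappa^+)$ be the statement $I[\kappa^+]\restriction S^{\kappa^+}_\kappa=\mathrm{NS}_{\kappa^+}\restriction S^{\kappa^+}_\kappa$. **Theorem.** Let $\kappa$ be a regular uncountable cardinal. If $\mathrm{GMP}^+(\kappa^{++},\kappa)$ holds, then $\mathrm{MP}(\kappa^+)$ holds. -/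

import Mathlib

open Set

universe u

namespace GuessingModels

/-! ### The first-order language of set theory and elementary submodels -/

/-- The only symbol of the language of set theory: a binary relation symbol for membership. -/
inductive MemRel : ℕ → Type
  | mem : MemRel 2

/-- The first-order language of set theory. -/
def setLanguage : FirstOrder.Language.{0, 0} :=
  ⟨fun _ => Empty, MemRel⟩

/-- Every class `X` of sets is a structure `(X, ∈)` for the language of set theory. -/
instance memStructure (X : Set ZFSet.{u}) : setLanguage.Structure X where
  funMap := fun f => Empty.elim f
  RelMap := fun r => match r with
    | MemRel.mem => fun v => (v 0 : ZFSet.{u}) ∈ (v 1 : ZFSet.{u})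

/-- `M ≺ H`: the set `M` is an elementary submodel of `(H, ∈)`. -/
def IsElementary (M : ZFSet.{u}) (H : Set ZFSet.{u}) : Prop :=
  ∃ h : (M : Set ZFSet.{u}) ⊆ H,
    ∀ (n : ℕ) (φ : setLanguage.Formula (Fin n)) (v : Fin n → (M : Set ZFSet.{u})),
      φ.Realize (Set.inclusion h ∘ v) ↔ φ.Realize v

/-- A powerful model: a transitive set or class `H` that contains every set bounded in `H`
(that is, every subset of an element of `H`) and satisfies `ZFC` without the power set axiom.
Extensionality and foundation hold in every transitive class; separation and choice follow from
the remaining clauses, because `H` contains all subsets of its elements. -/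
structure IsPowerful (H : Set ZFSet.{u}) : Prop where
  trans : ∀ x ∈ H, ∀ y ∈ x, y ∈ H
  bounded_mem : ∀ y ∈ H, ∀ x : ZFSet.{u}, x ⊆ y → x ∈ H
  infinity : ZFSet.omega ∈ H
  pairing : ∀ x ∈ H, ∀ y ∈ H, ({x, y} : ZFSet.{u}) ∈ H
  union : ∀ x ∈ H, (ZFSet.sUnion x) ∈ H
  /-- The replacement schema, for relations first-order definable over `(H, ∈)` with parameters. -/
  replacement : ∀ R : Set (H × H), (univ : Set H).Definable₂ setLanguage R →
    ∀ a : H, (∀ x : H, x.1 ∈ a.1 → ∃! y : H, (x, y) ∈ R) →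
      ∃ b : H, ∀ y : H, y.1 ∈ b.1 ↔ ∃ x : H, x.1 ∈ a.1 ∧ (x, y) ∈ R

/-- `H_θ`: the sets whose transitive closure has size less than `θ`; equivalently, the sets that
are included in some transitive set of size less than `θ`. -/
def hereditary (θ : Cardinal.{u}) : Set ZFSet.{u} :=
  {x | ∃ t : ZFSet.{u}, t.IsTransitive ∧ x ⊆ t ∧ t.card < θ}

/-! ### Guessing models -/

/-- The cardinal `δ` as a set, i.e. as an initial von Neumann ordinal. -/
noncomputable def cardSet (δ : Cardinal.{u}) : ZFSet.{u} :=
  δ.ord.toZFSet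

/-- `|a|^M < δ`: some element of `M` is an injective function from `a` to an ordinal `β < δ`
with `β ∈ M`. -/
def CardLTIn (M : ZFSet.{u}) (a : ZFSet.{u}) (δ : Cardinal.{u}) : Prop :=
  ∃ β ∈ M, β ∈ cardSet δ ∧ ∃ f ∈ M, ZFSet.IsFunc a β f ∧
    ∀ x y z : ZFSet.{u}, ZFSet.pair x z ∈ f → ZFSet.pair y z ∈ f → x = y

/-- `x` is bounded in `M`. -/
def IsBoundedIn (x M : ZFSet.{u}) : Prop :=
  ∃ y ∈ M, x ⊆ y

/-- `x` is guessed in `M`. -/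
def IsGuessedIn (x M : ZFSet.{u}) : Prop :=
  ∃ x' ∈ M, x' ∩ M = x ∩ M

/-- `x` is `δ`-approximated in `M`. -/
def IsApproximatedIn (δ : Cardinal.{u}) (x M : ZFSet.{u}) : Prop :=
  ∀ a ∈ M, CardLTIn M a δ → x ∩ a ∈ M

/-- `κ_M = α`: the ordinal `α` is the least one with `α ∈ M` and `α ⊈ M`. -/
def IsKappa (M : ZFSet.{u}) (α : Ordinal.{u}) : Prop :=
  IsLeast {β : Ordinal.{u} | β.toZFSet ∈ M ∧ ¬ β.toZFSet ⊆ M} α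

/-- `M` is a `δ`-guessing elementary submodel (for a regular cardinal `δ`): it is an elementary
submodel of some powerful model, `κ_M` is defined, `δ ∈ M`, `δ ≤ κ_M`, and every set that is
bounded and `δ`-approximated in `M` is guessed in `M`. -/
def IsGuessingESM (δ : Cardinal.{u}) (M : ZFSet.{u}) : Prop :=
  (∃ H : Set ZFSet.{u}, IsPowerful H ∧ IsElementary M H) ∧
  cardSet δ ∈ M ∧
  (∃ α : Ordinal.{u}, IsKappa M α ∧ δ.ord ≤ α) ∧
  ∀ x : ZFSet.{u}, IsBoundedIn x M → IsApproximatedIn δ x M → IsGuessedIn x M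

/-- `M`, of cardinality `κ⁺`, is a strongly `δ`-guessing model: it is the union of an
`∈`-increasing chain `⟨N ξ : ξ < κ⁺⟩` of `δ`-guessing elementary submodels of cardinality `κ`
which is continuous at all `ξ < κ⁺` of cofinality `κ`. -/
def IsStronglyGuessing (κ δ : Cardinal.{u}) (M : ZFSet.{u}) : Prop :=
  M.card = Order.succ κ ∧
  ∃ N : Ordinal.{u} → ZFSet.{u},
    (∀ ξ < (Order.succ κ).ord, IsGuessingESM δ (N ξ) ∧ (N ξ).card = κ) ∧
    (∀ ξ η : Ordinal.{u}, ξ < η → η < (Order.succ κ).ord → N ξ ∈ N η) ∧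
    (∀ ξ < (Order.succ κ).ord, ξ.cof = κ → ∀ x, x ∈ N ξ ↔ ∃ η < ξ, x ∈ N η) ∧
    (∀ x, x ∈ M ↔ ∃ ξ < (Order.succ κ).ord, x ∈ N ξ)

/-- `S ⊆ P_μ(X)` is stationary: for every `F : P_ω(X) → P_μ(X)` some `A ∈ S` is closed
under `F`. -/
def IsStationaryIn (μ : Cardinal.{u}) (X : Set ZFSet.{u}) (S : Set ZFSet.{u}) : Prop :=
  ∀ F : Finset ZFSet.{u} → ZFSet.{u},
    (∀ a : Finset ZFSet.{u}, (a : Set ZFSet.{u}) ⊆ X →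
      (F a : Set ZFSet.{u}) ⊆ X ∧ (F a).card < μ) →
    ∃ A ∈ S, ∀ a : Finset ZFSet.{u},
      (a : Set ZFSet.{u}) ⊆ (A : Set ZFSet.{u}) → F a ⊆ A

/-- `𝔊⁺_{κ⁺⁺,δ}(H)`: the `M ∈ P_{κ⁺⁺}(H)` with `M ≺ H` that are strongly `δ`-guessing. -/
def stronglyGuessingModels (κ δ : Cardinal.{u}) (H : Set ZFSet.{u}) : Set ZFSet.{u} :=
  {M | (M : Set ZFSet.{u}) ⊆ H ∧ M.card < Order.succ (Order.succ κ) ∧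
    IsElementary M H ∧ IsStronglyGuessing κ δ M}

/-- `GMP⁺(κ⁺⁺, δ)`: for all sufficiently large regular `θ`, the set `𝔊⁺_{κ⁺⁺,δ}(H_θ)` is
stationary in `P_{κ⁺⁺}(H_θ)`. -/
def GMPPlus (κ δ : Cardinal.{u}) : Prop :=
  ∃ θ₀ : Cardinal.{u}, ∀ θ : Cardinal.{u}, θ₀ ≤ θ → θ.IsRegular →
    IsStationaryIn (Order.succ (Order.succ κ)) (hereditary θ)
      (stronglyGuessingModels κ δ (hereditary θ))

/-! ### The approachability ideal -/

/-- A cardinal `lam` as a linear order: the ordinals below it. -/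
abbrev Below (lam : Cardinal.{u}) : Type (u + 1) :=
  Iio lam.ord

/-- A `lam`-approaching sequence: a `lam`-sequence of bounded subsets of `lam`. -/
def IsApproaching {lam : Cardinal.{u}} (a : Below lam → Set (Below lam)) : Prop :=
  ∀ ξ, BddAbove (a ξ)

/-- `B(a)`: the `δ < lam` that have a cofinal subset `c ⊆ δ` of order type less than `δ`, each of
whose proper initial segments `c ∩ γ`, `γ < δ`, is `a η` for some `η < δ`. -/
def approachable {lam : Cardinal.{u}} (a : Below lam → Set (Below lam)) : Set (Below lam) :=
  {δ | ∃ c : Set (Below lam), c ⊆ Iio δ ∧ (∀ x < δ, ∃ y ∈ c, x ≤ y) ∧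
    Ordinal.type (fun x y : c => x < y) < Ordinal.lift.{u + 1} δ.1 ∧
    ∀ γ < δ, ∃ η < δ, c ∩ Iio γ = a η}

/-- The nonstationary ideal on `lam`. -/
def nonstationary (lam : Cardinal.{u}) : Set (Set (Below lam)) :=
  {A | ¬ IsStationary A}

/-- The approachability ideal `I[lam]`: the ideal of subsets of `lam` (not necessarily proper)
generated by the nonstationary sets and the sets `B(a)`, for all `lam`-approaching sequences `a`. -/
def approachabilityIdeal (lam : Cardinal.{u}) : Order.Ideal (Set (Below lam)) :=
  sInf {J | (∀ a : Below lam → Set (Below lam), IsApproaching a → approachable a ∈ J) ∧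
    ∀ A ∈ nonstationary lam, A ∈ J}

/-- The restriction of an ideal to a set `S`: its members that are subsets of `S`. -/
def restrictTo {X : Type*} (I : Set (Set X)) (S : Set X) : Set (Set X) :=
  {A | A ∈ I ∧ A ⊆ S}

/-- The set of ordinals below `lam` of cofinality `κ`. -/
def cofinalityPoints (lam κ : Cardinal.{u}) : Set (Below lam) :=
  {δ | δ.1.cof = κ}

/-- `MP(κ⁺)`: the approachability ideal and the nonstationary ideal on `κ⁺` have the same
restriction to the points of cofinality `κ`. -/
def MP (κ : Cardinal.{u}) : Prop :=
  restrictTo (approachabilityIdeal (Order.succ κ) : Set (Set (Below (Order.succ κ))))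
      (cofinalityPoints (Order.succ κ) κ) =
    restrictTo (nonstationary (Order.succ κ)) (cofinalityPoints (Order.succ κ) κ)

end GuessingModels

namespace GuessingModels

/-! ### Elementary submodels of powerful models -/

/-! Fix a sequence `a` of subsets of κ⁺ and a strongly guessing `M` that includes κ⁺ and contains
κ⁺, `a` and the function computing order types of initial segments. Closing off along the chain `N`
gives a club of κ⁺ such that, for each α of cofinality κ in it, `N α` contains these parameters and
meets κ⁺ exactly in α. No such α is approachable (`IsGuessingESM.notMem_approachable`). Indeed, let
`c` witness approachability. A set of size below κ meets α in a bounded set, so its trace on `c` can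
be read off from some `a η` with η < α; thus `c` is approximated in `N α`, hence guessed by some `s`
in `N α` with `s ∩ α = c`. The order type ρ of `c` is below α, so it lies in `N α`. By elementarity
some γ in `N α`, hence γ < α, satisfies otp(`s ∩ γ`) = ρ = otp(`s ∩ α`), which is impossible because
`c` is cofinal in α. -/

open FirstOrder FirstOrder.Language in
theorem IsElementary.exists_realize {M : ZFSet.{u}} {H : Set ZFSet.{u}} (h : IsElementary M H)
    {n : ℕ} (φ : setLanguage.BoundedFormula (Fin n) 1) (v : Fin n → (M : Set ZFSet.{u}))
    (x : H) (hx : φ.Realize (Set.inclusion h.1 ∘ v) (fun _ => x)) :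
    ∃ y : (M : Set ZFSet.{u}),
      φ.Realize (Set.inclusion h.1 ∘ v) (fun _ => Set.inclusion h.1 y) := by
  obtain ⟨hMH, hel⟩ := h
  let e : (M : Set ZFSet.{u}) ↪ₑ[setLanguage] H := ⟨Set.inclusion hMH, fun n φ v => hel n φ v⟩
  have h1 : (BoundedFormula.ex φ).Realize (e ∘ v) (e ∘ default) := by
    rw [BoundedFormula.realize_ex]
    refine ⟨x, ?_⟩
    convert hx using 1
    · rfl
    · exact funext fun i : Fin 1 => by fin_cases i; rfl
  rw [e.map_boundedFormula, BoundedFormula.realize_ex] at h1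
  obtain ⟨y, hy⟩ := h1
  refine ⟨y, ?_⟩
  rw [← e.map_boundedFormula] at hy
  convert hy using 1
  · rfl
  · exact funext fun i : Fin 1 => by fin_cases i; rfl

/-- The atomic formula `s ∈ t`. -/
def memFormula {α : Type} {n : ℕ} (s t : setLanguage.Term (α ⊕ Fin n)) :
    setLanguage.BoundedFormula α n :=
  FirstOrder.Language.Relations.boundedFormula₂ (L := setLanguage) MemRel.mem s t

@[simp]
theorem realize_memFormula {X : Set ZFSet.{u}} {α : Type} {n : ℕ}
    (s t : setLanguage.Term (α ⊕ Fin n)) (v : α → X) (xs : Fin n → X) :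
    (memFormula s t).Realize v xs ↔
      (s.realize (Sum.elim v xs) : X).1 ∈ (t.realize (Sum.elim v xs) : X).1 :=
  FirstOrder.Language.BoundedFormula.realize_rel₂

open FirstOrder FirstOrder.Language in
-- The intersection is in `H` as a subset of `x`, and transitivity makes it definable there from `x`
-- and `y`.
theorem IsElementary.inter_mem {M : ZFSet.{u}} {H : Set ZFSet.{u}} (hH : IsPowerful H)
    (h : IsElementary M H) {x y : ZFSet.{u}} (hx : x ∈ M) (hy : y ∈ M) : x ∩ y ∈ M := by
  have key : ∀ z : H,
      (BoundedFormula.all (((memFormula (&1) (&0)).iff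
        ((memFormula (&1) (Term.var (Sum.inl 0))) ⊓ (memFormula (&1) (Term.var (Sum.inl 1))))) :
          setLanguage.BoundedFormula (Fin 2) 2)).Realize
        (Set.inclusion h.1 ∘ ![⟨x, hx⟩, ⟨y, hy⟩]) (fun _ => z) ↔ z.1 = x ∩ y := by
    intro z
    simp only [BoundedFormula.realize_all, BoundedFormula.realize_iff, BoundedFormula.realize_inf,
      realize_memFormula, Term.realize_var, Sum.elim_inl, Sum.elim_inr, Function.comp]
    simp only [Fin.snoc]
    simp only [Subtype.forall]
    constructor
    · intro hz
      ext w
      rw [ZFSet.mem_inter]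
      constructor
      · intro hw
        exact (hz w (hH.trans _ z.2 _ hw)).1 hw
      · rintro hw
        exact (hz w (hH.trans _ (h.1 hx) _ hw.1)).2 hw
    · rintro hz w -
      show w ∈ z.1 ↔ w ∈ x ∧ w ∈ y
      rw [hz, ZFSet.mem_inter]
  obtain ⟨z, hz⟩ := h.exists_realize _ _
    ⟨x ∩ y, hH.bounded_mem x (h.1 hx) _ fun w hw => (ZFSet.mem_inter.1 hw).1⟩ ((key _).2 rfl)
  exact (show z.1 = x ∩ y from (key _).1 hz) ▸ z.2

/-- Absoluteness of the Kuratowski pair: transitivity keeps all relevant elements in `H`, and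
pairing supplies `{x}` and `{x, y}`. -/
theorem IsPowerful.eq_pair_iff {H : Set ZFSet.{u}} (hH : IsPowerful H) {x y p : ZFSet.{u}}
    (hx : x ∈ H) (hy : y ∈ H) (hp : p ∈ H) :
    (∀ w ∈ H, w ∈ p ↔ (∀ t ∈ H, t ∈ w ↔ t = x) ∨ (∀ t ∈ H, t ∈ w ↔ t = x ∨ t = y)) ↔
      p = ZFSet.pair x y := by
  have h1 : ∀ w ∈ H, (∀ t ∈ H, t ∈ w ↔ t = x) ↔ w = {x} := by
    intro w hw
    constructor
    · intro ht
      ext t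
      rw [ZFSet.mem_singleton]
      exact ⟨fun h => (ht t (hH.trans _ hw _ h)).1 h, fun h => (ht t (h ▸ hx)).2 h⟩
    · rintro rfl t -
      exact ZFSet.mem_singleton
  have h2 : ∀ w ∈ H, (∀ t ∈ H, t ∈ w ↔ t = x ∨ t = y) ↔ w = {x, y} := by
    intro w hw
    constructor
    · intro ht
      ext t
      rw [ZFSet.mem_pair]
      refine ⟨fun h => (ht t (hH.trans _ hw _ h)).1 h, fun h => (ht t ?_).2 h⟩
      rcases h with rfl | rfl <;> assumption
    · rintro rfl t -
      exact ZFSet.mem_pair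
  have h3 : ({x} : ZFSet.{u}) ∈ H := by
    have := hH.pairing x hx x hx
    rwa [ZFSet.pair_eq_singleton] at this
  have h4 := hH.pairing x hx y hy
  constructor
  · intro hw
    ext w
    rw [ZFSet.pair, ZFSet.mem_pair]
    constructor
    · intro h
      have hwH := hH.trans _ hp _ h
      rw [← h1 w hwH, ← h2 w hwH]
      exact (hw w hwH).1 h
    · intro h
      have hwH : w ∈ H := by rcases h with rfl | rfl <;> assumption
      rw [hw w hwH, h1 w hwH, h2 w hwH]
      exact h
  · rintro rfl w hw
    rw [h1 w hw, h2 w hw, ZFSet.pair, ZFSet.mem_pair]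

theorem IsPowerful.mem_of_pair_mem {H : Set ZFSet.{u}} (hH : IsPowerful H) {x y f : ZFSet.{u}}
    (hf : f ∈ H) (h : ZFSet.pair x y ∈ f) : x ∈ H ∧ y ∈ H := by
  have h1 := hH.trans _ (hH.trans _ hf _ h) {x, y} (by simp [ZFSet.pair])
  exact ⟨hH.trans _ h1 _ (by simp), hH.trans _ h1 _ (by simp)⟩

open FirstOrder FirstOrder.Language in
/-- The formula `(s, t) ∈ f`. -/
def pairMemFormula {α : Type} (s t f : α ⊕ Fin 1) : setLanguage.BoundedFormula α 1 :=
  let c : α ⊕ Fin 1 → α ⊕ Fin 4 := Sum.map id (Fin.castLE (by omega))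
  let c' : α ⊕ Fin 1 → α ⊕ Fin 2 := Sum.map id (Fin.castLE (by omega))
  BoundedFormula.ex (memFormula (&1) (Term.var (c' f)) ⊓
    BoundedFormula.all ((memFormula (&2) (&1)).iff
      (BoundedFormula.all ((memFormula (&3) (&2)).iff (Term.bdEqual (&3) (Term.var (c s)))) ⊔
        BoundedFormula.all ((memFormula (&3) (&2)).iff
          (Term.bdEqual (&3) (Term.var (c s)) ⊔ Term.bdEqual (&3) (Term.var (c t)))))))

open FirstOrder FirstOrder.Language in
theorem realize_pairMemFormula {H : Set ZFSet.{u}} (hH : IsPowerful H) {α : Type}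
    (s t f : α ⊕ Fin 1) (v : α → H) (z : H) :
    (pairMemFormula s t f).Realize v (fun _ => z) ↔
      ZFSet.pair (Sum.elim v (fun _ => z) s : H).1 (Sum.elim v (fun _ => z) t : H).1 ∈
        (Sum.elim v (fun _ => z) f : H).1 := by
  -- Variables present before the quantifiers keep their values when the valuation is extended by
  -- `Fin.snoc`.
  have key : ∀ p w r : H, ∀ s : α ⊕ Fin 1,
      (Sum.elim v (Fin.snoc (Fin.snoc (Fin.snoc (fun _ : Fin 1 => z) p) w) r : Fin 4 → H)
        (Sum.map id (Fin.castLE (by omega)) s)) = Sum.elim v (fun _ => z) s := by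
    rintro p w r (s | s)
    · rfl
    · fin_cases s; rfl
  have key' : ∀ p : H, ∀ s : α ⊕ Fin 1,
      (Sum.elim v (Fin.snoc (fun _ : Fin 1 => z) p : Fin 2 → H)
        (Sum.map id (Fin.castLE (by omega)) s)) = Sum.elim v (fun _ => z) s := by
    rintro p (s | s)
    · rfl
    · fin_cases s; rfl
  have e1 : ∀ p : H, (Fin.snoc (fun _ : Fin 1 => z) p : Fin 2 → H) 1 = p := fun p => rfl
  have e2 : ∀ p w : H, (Fin.snoc (Fin.snoc (fun _ : Fin 1 => z) p : Fin 2 → H) w : Fin 3 → H) 1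
    = p := fun p w => rfl
  have e3 : ∀ p w : H, (Fin.snoc (Fin.snoc (fun _ : Fin 1 => z) p : Fin 2 → H) w : Fin 3 → H) 2
    = w := fun p w => rfl
  have e4 : ∀ p w r : H, (Fin.snoc (Fin.snoc (Fin.snoc (fun _ : Fin 1 => z) p : Fin 2 → H) w :
    Fin 3 → H) r : Fin 4 → H) 2 = w := fun p w r => rfl
  have e5 : ∀ p w r : H, (Fin.snoc (Fin.snoc (Fin.snoc (fun _ : Fin 1 => z) p : Fin 2 → H) w :
    Fin 3 → H) r : Fin 4 → H) 3 = r := fun p w r => rfl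
  simp only [pairMemFormula, BoundedFormula.realize_ex, BoundedFormula.realize_all,
    BoundedFormula.realize_iff, BoundedFormula.realize_inf, BoundedFormula.realize_sup,
    BoundedFormula.realize_bdEqual, realize_memFormula, Term.realize_var, Function.comp, Sum.elim_inr,
    key, key', e1, e2, e3, e4, e5]
  constructor
  · rintro ⟨p, hp, hp'⟩
    rw [← (hH.eq_pair_iff (Subtype.coe_prop _) (Subtype.coe_prop _) p.2).1 ?_]
    · exact hp
    · simpa only [Subtype.forall, Subtype.ext_iff] using hp'
  · intro h
    have hp := hH.trans _ (Subtype.coe_prop _) _ h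
    refine ⟨⟨_, hp⟩, h, ?_⟩
    have := (hH.eq_pair_iff (Subtype.coe_prop _) (Subtype.coe_prop _) hp).2 rfl
    simpa only [Subtype.forall, Subtype.ext_iff] using this

/-- With `f` as a parameter, nothing about how `f` was defined need be expressed in `H`; this is how
codes of functions and order types are evaluated inside `M`. -/
theorem IsElementary.exists_snd_mem {M : ZFSet.{u}} {H : Set ZFSet.{u}} (hH : IsPowerful H)
    (h : IsElementary M H) {x y f : ZFSet.{u}} (hx : x ∈ M) (hf : f ∈ M)
    (hxy : ZFSet.pair x y ∈ f) : ∃ z ∈ M, ZFSet.pair x z ∈ f := by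
  obtain ⟨z, hz⟩ := h.exists_realize
    (pairMemFormula (α := Fin 2) (Sum.inl 0) (Sum.inr 0) (Sum.inl 1)) ![⟨x, hx⟩, ⟨f, hf⟩]
    ⟨y, (hH.mem_of_pair_mem (h.1 hf) hxy).2⟩ ((realize_pairMemFormula hH _ _ _ _ _).2 hxy)
  exact ⟨z, z.2, (realize_pairMemFormula hH _ _ _ _ _).1 hz⟩

/-! ### Closed unbounded sets and nonstationary sets -/

section Club
variable {α : Type*} [LinearOrder α] [WellFoundedLT α]

attribute [local instance]
  WellFoundedLT.toOrderBot WellFoundedLT.conditionallyCompleteLinearOrderBot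

/-- Unboundedness: iterate a bounding function ω times and take the supremum, which exists by
uncountable cofinality. -/
theorem isClub_of_closure (hα : Cardinal.aleph0 < Order.cof α) {P : α → α → Prop}
    (hmono : ∀ b x y, P b x → x ≤ y → P b y) (hP : ∀ x, ∃ y, ∀ b ≤ x, P b y) :
    IsClub {a | ∀ b < a, P b a} := by
  constructor
  · intro t ht _ _ a ha b hb
    obtain ⟨c, hc, hbc⟩ := (lt_isLUB_iff ha).1 hb
    exact hmono _ _ _ (ht hc b hbc) (ha.1 hc)
  · intro a
    have : Nonempty α := ⟨a⟩
    choose f hf using hP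
    let g : ℕ → α := fun n => f^[n] a
    have hg : BddAbove (range g) := by
      refine .of_not_isCofinal fun h => (Order.cof_le h).not_gt (hα.trans_le' ?_)
      simpa using Cardinal.mk_range_le_lift (f := g)
    refine ⟨sSup (range g), fun b hb => ?_, le_csSup hg ⟨0, rfl⟩⟩
    obtain ⟨_, ⟨n, rfl⟩, hbn⟩ := exists_lt_of_lt_csSup (range_nonempty g) hb
    refine hmono _ _ _ (hf (g n) b hbn.le) (le_csSup hg ⟨n + 1, ?_⟩)
    exact Function.iterate_succ_apply' f n a

end Club

theorem aleph0_lt_cof_below {κ : Cardinal.{u}} (hκ : Cardinal.aleph0 ≤ κ) :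
    Cardinal.aleph0 < Order.cof (Below (Order.succ κ)) := by
  rw [Ordinal.cof_Iio, ← Ordinal.lift_cof, (Cardinal.isRegular_succ hκ).cof_ord,
    Cardinal.aleph0_lt_lift]
  exact hκ.trans_lt (Order.lt_succ κ)

/-- The sets whose intersection with `S` is nonstationary form an ideal. -/
def nonstationaryOn {lam : Cardinal.{u}} (hlam : Order.cof (Below lam) ≠ Cardinal.aleph0)
    (S : Set (Below lam)) :
    Order.Ideal (Set (Below lam)) where
  carrier := {A | ¬ IsStationary (A ∩ S)}
  lower' _ _ h hA hB := hA (hB.mono (inter_subset_inter_left S h))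
  nonempty' := ⟨∅, by simp⟩
  directed' A hA B hB := ⟨A ∪ B, by
    show ¬ IsStationary ((A ∪ B) ∩ S)
    rw [union_inter_distrib_right, isStationary_union_iff hlam]
    exact not_or.2 ⟨hA, hB⟩, subset_union_left, subset_union_right⟩

/-- By `h`, `nonstationaryOn` is one of the ideals whose intersection is the approachability ideal.
-/
theorem MP_of_approachable {κ : Cardinal.{u}} (hκ : Cardinal.aleph0 ≤ κ)
    (h : ∀ a : Below (Order.succ κ) → Set (Below (Order.succ κ)), IsApproaching a →
      ¬ IsStationary (approachable a ∩ cofinalityPoints (Order.succ κ) κ)) : MP κ := by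
  have hcof := (aleph0_lt_cof_below hκ).ne'
  refine Subset.antisymm ?_ ?_
  · rintro A ⟨hA, hAS⟩
    refine ⟨?_, hAS⟩
    have := Order.Ideal.mem_sInf.1 hA
      (nonstationaryOn hcof (cofinalityPoints (Order.succ κ) κ))
      ⟨h, fun B hB hBS => hB (hBS.mono inter_subset_left)⟩
    rwa [← inter_eq_left.2 hAS]
  · rintro A ⟨hA, hAS⟩
    exact ⟨Order.Ideal.mem_sInf.2 fun J hJ => hJ.2 A hA, hAS⟩

/-! ### Coding by sets -/

theorem mem_hereditary {x t : ZFSet.{u}} {θ : Cardinal.{u}} (ht : t.IsTransitive) (hx : x ∈ t)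
    (hθ : t.card < θ) : x ∈ hereditary θ :=
  ⟨t, ht, ht x hx, hθ⟩

variable {lam : Cardinal.{u}}

/-- A set of ordinals below `lam` as an element of the universe of sets. -/
noncomputable def code (s : Set (Below lam)) : ZFSet.{u} :=
  ZFSet.sep (fun z => ∃ x ∈ s, x.1.toZFSet = z) (cardSet lam)

theorem toZFSet_mem_cardSet {b : Ordinal.{u}} : b.toZFSet ∈ cardSet lam ↔ b < lam.ord :=
  Ordinal.toZFSet_mem_toZFSet_iff

theorem mem_code {s : Set (Below lam)} {z : ZFSet.{u}} :
    z ∈ code s ↔ ∃ x ∈ s, x.1.toZFSet = z := by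
  rw [code, ZFSet.mem_sep]
  refine ⟨fun h => h.2, fun h => ⟨?_, h⟩⟩
  obtain ⟨x, -, rfl⟩ := h
  exact toZFSet_mem_cardSet.2 x.2

theorem toZFSet_mem_code {s : Set (Below lam)} {x : Below lam} : x.1.toZFSet ∈ code s ↔ x ∈ s := by
  rw [mem_code]
  constructor
  · rintro ⟨y, hy, hxy⟩
    rwa [← Subtype.ext (Ordinal.toZFSet_injective hxy)]
  · exact fun h => ⟨x, h, rfl⟩

theorem code_subset (s : Set (Below lam)) : code s ⊆ cardSet lam :=
  ZFSet.sep_subset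

/-- A sequence of subsets of `lam` as a set of pairs. -/
noncomputable def codeSeq (a : Below lam → Set (Below lam)) : ZFSet.{u} :=
  ZFSet.range fun ξ : Below lam => ZFSet.pair ξ.1.toZFSet (code (a ξ))

theorem pair_mem_codeSeq {a : Below lam → Set (Below lam)} {ξ : Below lam} {z : ZFSet.{u}} :
    ZFSet.pair ξ.1.toZFSet z ∈ codeSeq a ↔ z = code (a ξ) := by
  rw [codeSeq, ZFSet.mem_range]
  constructor
  · rintro ⟨η, hη⟩
    obtain ⟨h1, rfl⟩ := ZFSet.pair_inj.1 hη
    rw [Subtype.ext (Ordinal.toZFSet_injective h1)]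
  · rintro rfl
    exact ⟨ξ, rfl⟩

/-- The set of all pairs `(ρ, γ)` of ordinals below `lam` such that `s ∩ γ` has order type `ρ`. -/
noncomputable def typeGraph (s : Set (Below lam)) : ZFSet.{u} :=
  ZFSet.range fun p : {p : Below lam × Below lam //
      Ordinal.type (fun x y : (s ∩ Iio p.2 : Set (Below lam)) => x < y) =
        Ordinal.lift.{u + 1} p.1.1} =>
    ZFSet.pair p.1.1.1.toZFSet p.1.2.1.toZFSet

theorem pair_mem_typeGraph {s : Set (Below lam)} {ρ : Below lam} {z : ZFSet.{u}} :
    ZFSet.pair ρ.1.toZFSet z ∈ typeGraph s ↔ ∃ γ : Below lam, z = γ.1.toZFSet ∧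
      Ordinal.type (fun x y : (s ∩ Iio γ : Set (Below lam)) => x < y) =
        Ordinal.lift.{u + 1} ρ.1 := by
  rw [typeGraph, ZFSet.mem_range]
  constructor
  · rintro ⟨⟨⟨ρ', γ⟩, h⟩, hp⟩
    obtain ⟨h1, rfl⟩ := ZFSet.pair_inj.1 hp
    obtain rfl := Subtype.ext (Ordinal.toZFSet_injective h1)
    exact ⟨γ, rfl, h⟩
  · rintro ⟨γ, rfl, h⟩
    exact ⟨⟨⟨ρ, γ⟩, h⟩, rfl⟩

/-- The function `s ↦ typeGraph s` on the subsets of `lam`, as a set of pairs. -/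
noncomputable def typeGraphs (lam : Cardinal.{u}) : ZFSet.{u} :=
  ZFSet.range fun s : Set (Below lam) => ZFSet.pair (code s) (typeGraph s)

theorem code_injective : Function.Injective (code (lam := lam)) := by
  intro s t h
  ext x
  rw [← toZFSet_mem_code, h, toZFSet_mem_code]

theorem pair_mem_typeGraphs {s : Set (Below lam)} {z : ZFSet.{u}} :
    ZFSet.pair (code s) z ∈ typeGraphs lam ↔ z = typeGraph s := by
  rw [typeGraphs, ZFSet.mem_range]
  constructor
  · rintro ⟨t, hp⟩
    obtain ⟨h1, rfl⟩ := ZFSet.pair_inj.1 hp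
    rw [code_injective h1]
  · rintro rfl
    exact ⟨s, rfl⟩

/-! ### Approachable points of guessing models -/

theorem exists_bound_of_card_lt_cof {x : ZFSet.{u}} {o : Ordinal.{u}} (h : x.card < o.cof) :
    ∃ z < o, ∀ b < o, b.toZFSet ∈ x → b < z := by
  let s : Set Ordinal.{u} := {b | b < o ∧ b.toZFSet ∈ x}
  have hs : Cardinal.mk s < (Ordinal.lift.{u + 1} o).cof := by
    rw [← Ordinal.lift_cof]
    refine lt_of_le_of_lt ?_ (Cardinal.lift_lt.2 h)
    rw [← ZFSet.cardinalMk_coe_sort]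
    exact Cardinal.mk_le_of_injective (f := fun b : s => (⟨b.1.toZFSet, b.2.2⟩ : x))
      fun b c hbc => Subtype.ext (Ordinal.toZFSet_injective (congrArg Subtype.val hbc))
  refine ⟨_, Ordinal.sSup_add_one_lt_of_lt_cof hs fun i hi => hi.1, fun b hb hbx => ?_⟩
  refine (lt_add_one b).trans_le (le_csSup ⟨o, ?_⟩ ⟨b, ⟨hb, hbx⟩, rfl⟩)
  rintro _ ⟨c, hc, rfl⟩
  exact Order.add_one_le_of_lt hc.1

theorem CardLTIn.card_lt {M a : ZFSet.{u}} {δ : Cardinal.{u}} (h : CardLTIn M a δ) :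
    a.card < δ := by
  obtain ⟨β, -, hβ, f, -, ⟨hf, hf'⟩, hinj⟩ := h
  obtain ⟨b, hb, rfl⟩ := Ordinal.mem_toZFSet_iff.1 hβ
  refine lt_of_le_of_lt ?_ (Cardinal.lt_ord.1 hb)
  rw [← Ordinal.card_toZFSet, ← Cardinal.lift_le.{u + 1}, ← ZFSet.cardinalMk_coe_sort,
    ← ZFSet.cardinalMk_coe_sort]
  choose g hg using fun x : a => (hf' x.1 x.2).exists
  refine Cardinal.mk_le_of_injective
    (f := fun x => (⟨g x, (ZFSet.pair_mem_prod.1 (hf (hg x))).2⟩ : b.toZFSet)) fun x y hxy => ?_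
  have hxy' : g x = g y := congrArg Subtype.val hxy
  exact Subtype.ext (hinj _ _ _ (hg x) (hxy' ▸ hg y))

/-- An isomorphism would give a strictly increasing self-map of the well-order `s ∩ Iio α` with all
values below `γ`; such a map cannot move `y` down. -/
theorem type_inter_Iio_ne {X : Type*} [LinearOrder X] [WellFoundedLT X] {s : Set X} {γ α y : X}
    (hγ : γ ≤ α) (hy : y ∈ s) (hγy : γ ≤ y) (hyα : y < α) :
    Ordinal.type (fun x y : (s ∩ Iio γ : Set X) => x < y) ≠
      Ordinal.type (fun x y : (s ∩ Iio α : Set X) => x < y) := by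
  intro h
  obtain ⟨e⟩ := Ordinal.type_eq.1 h
  let f : (s ∩ Iio α : Set X) → (s ∩ Iio α : Set X) :=
    fun x => ⟨(e.symm x).1, (e.symm x).2.1, lt_of_lt_of_le (e.symm x).2.2 hγ⟩
  have hf : StrictMono f := fun a b hab => (e.symm.map_rel_iff.2 hab :)
  have h1 : y ≤ (e.symm ⟨y, hy, hyα⟩).1 := hf.le_apply (x := ⟨y, hy, hyα⟩)
  exact absurd (h1.trans_lt (e.symm ⟨y, hy, hyα⟩).2.2) hγy.not_gt

theorem IsGuessingESM.notMem_approachable {κ : Cardinal.{u}} {N : ZFSet.{u}}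
    (hN : IsGuessingESM κ N) {a : Below (Order.succ κ) → Set (Below (Order.succ κ))}
    {α : Below (Order.succ κ)} (hα : α.1.cof = κ)
    (hNα : ∀ b : Below (Order.succ κ), b.1.toZFSet ∈ N ↔ b < α)
    (hlam : cardSet (Order.succ κ) ∈ N) (ha : codeSeq a ∈ N)
    (ht : typeGraphs (Order.succ κ) ∈ N) : α ∉ approachable a := by
  rintro ⟨c, hcα, hcof, htype, hinit⟩
  obtain ⟨⟨H, hH, hel⟩, -, -, hguess⟩ := hN
  -- Since `x` has size below cof α = κ, some γ < α bounds `x ∩ α`, so `c ∩ x = a η ∩ x`.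
  have happrox : IsApproximatedIn κ (code c) N := by
    intro x hx hxκ
    obtain ⟨γ, hγα, hγ⟩ := exists_bound_of_card_lt_cof (o := α.1) (hα.symm ▸ hxκ.card_lt)
    obtain ⟨η, hη, hcη⟩ := hinit ⟨γ, hγα.trans α.2⟩ hγα
    obtain ⟨z, hz, hηz⟩ := hel.exists_snd_mem hH ((hNα η).2 hη) ha (pair_mem_codeSeq.2 rfl)
    rw [pair_mem_codeSeq] at hηz
    subst hηz
    convert hel.inter_mem hH hz hx using 1
    rw [← hcη]
    ext w
    simp only [ZFSet.mem_inter, and_congr_left_iff, mem_code]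
    rintro hw
    constructor
    · rintro ⟨b, hb, rfl⟩
      exact ⟨b, ⟨hb, hγ _ (hcα hb) hw⟩, rfl⟩
    · rintro ⟨b, hb, rfl⟩
      exact ⟨b, hb.1, rfl⟩
  obtain ⟨x, hx, hxc⟩ := hguess _ ⟨_, hlam, code_subset c⟩ happrox
  -- The guess is cut down to κ⁺ so that it has a `code`; this code stays in `N`.
  let s : Set (Below (Order.succ κ)) := {b | b.1.toZFSet ∈ x}
  have hs : s ∩ Iio α = c := by
    have h1 : ∀ b, b < α → (b ∈ s ↔ b ∈ c) := by
      intro b hb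
      have := congrArg (b.1.toZFSet ∈ ·) hxc
      simp only [ZFSet.mem_inter, (hNα b).2 hb, and_true, toZFSet_mem_code] at this
      exact this.to_iff
    ext b
    exact ⟨fun h => (h1 b h.2).1 h.1, fun h => ⟨(h1 b (hcα h)).2 h, hcα h⟩⟩
  have hsN : code s ∈ N := by
    convert hel.inter_mem hH hx hlam using 1
    ext w
    rw [ZFSet.mem_inter, mem_code]
    constructor
    · rintro ⟨b, hb, rfl⟩
      exact ⟨hb, toZFSet_mem_cardSet.2 b.2⟩
    · rintro ⟨hw, hw'⟩
      obtain ⟨b, hb, rfl⟩ := Ordinal.mem_toZFSet_iff.1 hw'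
      exact ⟨⟨b, hb⟩, hw, rfl⟩
  obtain ⟨z, hz, hsz⟩ := hel.exists_snd_mem hH hsN ht (pair_mem_typeGraphs.2 rfl)
  rw [pair_mem_typeGraphs] at hsz
  subst hsz
  obtain ⟨ρ, hρα, hρ⟩ := Ordinal.lt_lift_iff.1 htype
  let ρ' : Below (Order.succ κ) := ⟨ρ, hρα.trans α.2⟩
  have hpair : ZFSet.pair ρ'.1.toZFSet α.1.toZFSet ∈ typeGraph s := by
    refine pair_mem_typeGraph.2 ⟨α, rfl, ?_⟩
    rw [hs]
    exact hρ.symm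
  -- α itself witnesses that an initial segment of `s` has type ρ; elementarity finds a witness in
  -- `N`, hence below α.
  obtain ⟨w, hw, hρw⟩ := hel.exists_snd_mem hH ((hNα ρ').2 hρα) hz hpair
  obtain ⟨γ, rfl, hγ⟩ := pair_mem_typeGraph.1 hρw
  have hγα := (hNα γ).1 hw
  obtain ⟨y, hy, hγy⟩ := hcof γ hγα
  refine type_inter_Iio_ne hγα.le (hs.symm ▸ hy : y ∈ s ∩ Iio α).1 hγy (hcα hy) ?_
  rw [hγ, hs]
  exact hρ

/-- Initial segments have size at most κ, so regularity of κ⁺ bounds the chosen witnesses. -/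
theorem exists_forall_le_of_mono {κ : Cardinal.{u}} (hκ : Cardinal.aleph0 ≤ κ)
    {P : Below (Order.succ κ) → Below (Order.succ κ) → Prop}
    (hmono : ∀ b x y, P b x → x ≤ y → P b y) (hP : ∀ b, ∃ y, P b y)
    (x : Below (Order.succ κ)) : ∃ y, ∀ b ≤ x, P b y := by
  choose f hf using hP
  have hlim := Cardinal.isSuccLimit_ord (hκ.trans (Order.le_succ κ))
  have hcard : Cardinal.mk (f '' Iic x) < Order.cof (Below (Order.succ κ)) := by
    rw [Ordinal.cof_Iio, ← Ordinal.lift_cof, (Cardinal.isRegular_succ hκ).cof_ord]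
    refine lt_of_le_of_lt (b := Cardinal.mk (Iio (Order.succ x.1))) ?_ ?_
    · refine Cardinal.mk_image_le.trans
        (Cardinal.mk_le_of_injective (f := fun b => ⟨b.1.1, mem_Iio.2 (Order.lt_succ_iff.2 b.2)⟩)
          fun b c h => ?_)
      exact Subtype.ext (Subtype.ext (Subtype.mk.inj h))
    · rw [Cardinal.mk_Iio_ordinal, Cardinal.lift_lt, ← Cardinal.lt_ord]
      exact hlim.succ_lt x.2
  obtain ⟨y, hy⟩ := BddAbove.of_not_isCofinal fun h => (Order.cof_le h).not_gt hcard
  exact ⟨y, fun b hb => hmono b _ y (hf b) (hy ⟨b, hb, rfl⟩)⟩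

theorem GMPPlus.exists_isStronglyGuessing {κ δ : Cardinal.{u}} (h : GMPPlus κ δ)
    (x : ZFSet.{u}) (hx : x.card < Order.succ (Order.succ κ)) :
    ∃ M, x ⊆ M ∧ IsStronglyGuessing κ δ M := by
  obtain ⟨θ₀, hθ₀⟩ := h
  let t := ZFSet.vonNeumann x.rank
  let θ : Cardinal.{u} := Order.succ (max θ₀ (max Cardinal.aleph0 t.card))
  have hle : max θ₀ (max Cardinal.aleph0 t.card) < θ := Order.lt_succ _
  -- Closure under the constant function with value `x`, applied to the empty set, gives `x ⊆ M`.
  obtain ⟨M, ⟨-, -, -, hM⟩, hF⟩ := hθ₀ θ ((le_max_left _ _).trans hle.le)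
    (Cardinal.isRegular_succ ((le_max_left _ _).trans (le_max_right _ _))) (fun _ => x)
    fun _ _ => ⟨fun y hy => mem_hereditary (ZFSet.isTransitive_vonNeumann _)
      (ZFSet.subset_vonNeumann_self x hy)
      (((le_max_right _ _).trans (le_max_right _ _)).trans_lt hle), hx⟩
  exact ⟨M, hF ∅ (by simp), hM⟩

theorem GMPPlus.not_isStationary_approachable {κ : Cardinal.{u}} (hreg : κ.IsRegular)
    (h : GMPPlus κ κ) (a : Below (Order.succ κ) → Set (Below (Order.succ κ))) :
    ¬ IsStationary (approachable a ∩ cofinalityPoints (Order.succ κ) κ) := by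
  have hκ := hreg.aleph0_le
  have hlam := hκ.trans (Order.le_succ κ)
  have hlim := Cardinal.isSuccLimit_ord hlam
  -- κ⁺ enters both as an element and as a subset, so that every ordinal below κ⁺ appears in the
  -- chain.
  let x : ZFSet.{u} := insert (cardSet (Order.succ κ)) (insert (codeSeq a)
    (insert (typeGraphs (Order.succ κ)) (cardSet (Order.succ κ))))
  have hx : x.card < Order.succ (Order.succ κ) := by
    rw [Order.lt_succ_iff]
    have h1 : ∀ y z : ZFSet.{u}, z.card ≤ Order.succ κ → (insert y z).card ≤ Order.succ κ :=
      fun y z hz => ZFSet.card_insert_le.trans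
        (Cardinal.add_le_of_le hlam hz (Cardinal.one_le_aleph0.trans hlam))
    refine h1 _ _ (h1 _ _ (h1 _ _ ?_))
    rw [cardSet, Ordinal.card_toZFSet, Cardinal.card_ord]
  obtain ⟨M, hxM, -, N, hN, -, hcont, hMN⟩ := h.exists_isStronglyGuessing x hx
  have hmem : ∀ y ∈ x, ∃ ξ < (Order.succ κ).ord, y ∈ N ξ := fun y hy => (hMN y).1 (hxM hy)
  obtain ⟨ξ₁, hξ₁, h₁⟩ := hmem (cardSet (Order.succ κ)) (by simp [x])
  obtain ⟨ξ₂, hξ₂, h₂⟩ := hmem (codeSeq a) (by simp [x])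
  obtain ⟨ξ₃, hξ₃, h₃⟩ := hmem (typeGraphs (Order.succ κ)) (by simp [x])
  -- At a closure point α of cofinality κ, the clauses put the parameters in `N α` and give `N α ∩
  -- κ⁺ ⊆ α` and `α ⊆ N α`, respectively.
  let P : Below (Order.succ κ) → Below (Order.succ κ) → Prop := fun b y =>
    max ξ₁ (max ξ₂ ξ₃) < y.1 ∧ (∀ β < (Order.succ κ).ord, β.toZFSet ∈ N b.1 → β < y.1) ∧
      ∃ η < y.1, b.1.toZFSet ∈ N η
  have hmono : ∀ b y z, P b y → y ≤ z → P b z := by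
    rintro b y z ⟨hy₁, hy₂, η, hη, hbη⟩ hyz
    exact ⟨hy₁.trans_le hyz, fun β hβ hβN => (hy₂ β hβ hβN).trans_le hyz, η, hη.trans_le hyz, hbη⟩
  have hP : ∀ b, ∃ y, P b y := by
    intro b
    obtain ⟨z, hz, hbz⟩ := exists_bound_of_card_lt_cof (x := N b.1) (o := (Order.succ κ).ord) (by
      rw [(hN b.1 b.2).2, (Cardinal.isRegular_succ hκ).cof_ord]
      exact Order.lt_succ κ)
    obtain ⟨η, hη, hbη⟩ := hmem b.1.toZFSet (by simp [x, toZFSet_mem_cardSet.2 b.2])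
    refine ⟨⟨max (Order.succ (max ξ₁ (max ξ₂ ξ₃))) (max z (Order.succ η)),
      max_lt (hlim.succ_lt (max_lt hξ₁ (max_lt hξ₂ hξ₃))) (max_lt hz (hlim.succ_lt hη))⟩, ?_, ?_,
      η, ?_, hbη⟩
    · exact (Order.lt_succ _).trans_le (le_max_left _ _)
    · exact fun β hβ hβN => (hbz β hβ hβN).trans_le ((le_max_left _ _).trans (le_max_right _ _))
    · exact (Order.lt_succ _).trans_le ((le_max_right _ _).trans (le_max_right _ _))
  intro hst
  obtain ⟨α, ⟨hαa, hα⟩, hαC⟩ := hst (isClub_of_closure (aleph0_lt_cof_below hκ) hmono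
    (exists_forall_le_of_mono hκ hmono hP))
  have hα' : α.1.cof = κ := hα
  have hα0 : 0 < α.1 := by
    rw [← Ordinal.cof_pos, hα']
    exact hreg.pos
  -- The first clause of `P` does not involve `b`, so any `b < α` will do.
  have hξ := (hαC ⟨0, hα0.trans α.2⟩ hα0).1
  have hNα : ∀ ξ ≤ max ξ₁ (max ξ₂ ξ₃), ∀ y ∈ N ξ, y ∈ N α.1 := fun ξ hle y hy =>
    (hcont α.1 α.2 hα' y).2 ⟨ξ, hle.trans_lt hξ, hy⟩
  refine (hN α.1 α.2).1.notMem_approachable hα' (fun b => ?_) (hNα _ (by simp) _ h₁)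
    (hNα _ (by simp) _ h₂) (hNα _ (by simp) _ h₃) hαa
  rw [hcont α.1 α.2 hα']
  constructor
  · rintro ⟨η, hη, hbη⟩
    exact (hαC ⟨η, hη.trans α.2⟩ hη).2.1 b.1 b.2 hbη
  · exact fun hb => (hαC b hb).2.2

end GuessingModels

theorem mainTheorem10 (κ : Cardinal.{u}) (hreg : κ.IsRegular) (hunc : Cardinal.aleph0 < κ)
    (h : GuessingModels.GMPPlus κ κ) : GuessingModels.MP κ :=
  GuessingModels.MP_of_approachable hunc.le fun a _ => h.not_isStationary_approachable hreg a
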